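/- Let $a\in(0,1)$, $A=1/a$, and let $\xi_1,\xi_2,\dots$ be independent, identically distributed, (almost surely) positive random variables. For $x\in\mathbb R$ consider the AR(1) chain $X_0=x$, $X_n=aX_{n-1}+\xi_n$ $(n\ge1)$, write $\mathbf P_x,\mathbf E_x$ for probability and expectation when the chain starts at $x$, and let $T^{(X)}_{x_0}=\inf\{k\ge1: X_k\le x_0\}$ (with $\inf\emptyset=\infty$). Put $\eta=\log_A\xi_1$, $F(y)=\mathbf P(\eta\le y)$ and $\overline F(y)=\mathbf P(\eta>y)$. Assume that $x_0\in\mathbb R$ is such that $\mathbf P(ax_0+\xi_1<x_0)>0$. Assume also that $\mathbf E\eta<\infty$ (that is, $\mathbf E\max(\eta,0)<\infty$), that $F$ is strong subexponential, $F\in\mathcal S^*$, i.e. $$\mu_+:=\int_0^\infty\overline F(y)\,dy<\infty,\qquad \overline F(x)>0\ \text{ for all } x\in\mathbb R,\qquad \lim_{x\to\infty}\frac{\int_0^x\overline F(x-y)\overline F(y)\,dy}{\overline F(x)}=2\mu_+,$$ and that $$\mathbf P(\eta>x)\sim\mathbf P(\eta>x-\log x)\qquad\text{as }x\to\infty.$$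 Then, for every $x>x_0$, one has $\mathbf E_x[T^{(X)}_{x_0}]<\infty$ and $$\mathbf P_x(T^{(X)}_{x_0}>n)\sim\mathbf E_x[T^{(X)}_{x_0}]\,\mathbf P(\eta>n)\qquad\text{as }n\to\infty.$$ -/

import Mathlib

open MeasureTheory ProbabilityTheory Filter Asymptotics
open scoped ENNReal Topology

noncomputable section

/-- The AR(1) chain `X₀ = x`, `Xₙ₊₁ = a Xₙ + ξₙ` driven by the innovations `ξ₀, ξ₁, …`
(so `ξ n` is the innovation used in the `(n+1)`-st step). -/
def arChain {Ω : Type*} (a : ℝ) (ξ : ℕ → Ω → ℝ) (x : ℝ) : ℕ → Ω → ℝ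
  | 0 => fun _ => x
  | n + 1 => fun ω => a * arChain a ξ x n ω + ξ n ω

/-- The recurrence time `inf {k ≥ 1 : X_k ≤ x₀}` of the AR(1) chain started at `x`;
it equals `⊤` when the chain never enters `(-∞, x₀]` at a time `k ≥ 1`. -/
def recurrenceTime {Ω : Type*} (a : ℝ) (ξ : ℕ → Ω → ℝ) (x₀ x : ℝ) : Ω → ℕ∞ :=
  hittingAfter (arChain a ξ x) (Set.Iic x₀) 1

/-- The tail `x ↦ μ((x, ∞))` of a distribution on the real line. -/
def distTail (μ : Measure ℝ) (x : ℝ) : ℝ := μ.real (Set.Ioi x)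

/-- The class `𝒮*` of strong subexponential distributions on the real line. -/
structure IsStrongSubexponential (μ : Measure ℝ) : Prop where
  isProbabilityMeasure : IsProbabilityMeasure μ
  /-- `μ₊ = ∫₀^∞ F̄(y) dy < ∞` -/
  integrableOn_tail : IntegrableOn (distTail μ) (Set.Ioi 0)
  tail_pos : ∀ x, 0 < distTail μ x
  tendsto_convolution :
    Tendsto (fun x => (∫ y in (0 : ℝ)..x, distTail μ (x - y) * distTail μ y) / distTail μ x)
      atTop (𝓝 (2 * ∫ y in Set.Ioi (0 : ℝ), distTail μ y))

end

/-!
Write `p n = P(T > n)` and `F y = P(η > y)`, so that `E T = ∑ p n`. On a logarithmic scale the chain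
moves down at unit speed and is lifted by large innovations, and it stays above `x₀` up to a late
time `n` essentially only if one innovation `ξ_k`, at some early time `k` reached without entering
`(-∞, x₀]`, exceeds `a⁻¹ ^ n`. Since `F` is long-tailed each such scenario has probability
`~ p k * F n`, and summing over `k` gives `E T * F n`.

Lower bound (`eventually_le_measureReal_survivalSet`): for fixed `K` the scenarios with `k < K` are
disjoint up to probability `O(F n ^ 2)`, and each of them forces `T > n`.

Upper bound: by `measureReal_survivalSet_recursion`, for each `ε > 0` there are a lag `W` and a
kernel `h` with `∑ h ≤ ε` and limsup `h / F ≤ 1` such that for all large `N`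
`p (N + W) ≤ ε * p N + ∑ j < N, p j * h (N - 1 - j)`.
To see this, split the time window after `N` into many long blocks. If `X_N` and all contributions
from within the window are moderate, then every block gives the chain a fresh chance, bounded below
and independent of the past, to fall below `x₀`. Failing all these chances, or a large contribution
from within the window, accounts for `ε * p N`. Otherwise `X_N` is large, and as the weights `1 / ((i + 1) (i + 2))` sum to at most `1`, some term `a ^ i * ξ_k` of
`X_N`, with `i = N - 1 - k`, exceeds its share of the total (`exists_large_innovation`). The
polynomial weight costs a shift of the argument of `F` by a multiple of `log`, and iterating
`F (y - log y) ~ F y` shows that the shift is harmless (`eventually_tail_sub_log_mul_le`).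

The theorem `renewal_inequality` is purely analytic: the inequality above implies `∑ p n < ∞`, since
its kernel has total mass less than one, and then limsup `p / F ≤ ∑ p`, because strong
subexponentiality (in the discrete form `eventually_convolution_middle_le`) makes the middle part of
the convolution negligible.
-/

/-! ### Renewal-type inequalities with a subexponential kernel -/

/-- Summing the inequality over `N` bounds each partial sum of `p` by a constant plus half of
itself. -/
theorem summable_of_renewal_inequality {p h : ℕ → ℝ} (hp : ∀ n, 0 ≤ p n) (hh : ∀ n, 0 ≤ h n)
    (hs : Summable h) (hsum : ∑' i, h i ≤ 1 / 4) {W N₀ : ℕ}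
    (hrec : ∀ N ≥ N₀, p (N + W) ≤ 1 / 4 * p N + ∑ j ∈ Finset.range N, p j * h (N - 1 - j)) :
    Summable p := by
  -- Interchanging the sums leaves the total mass of `h` as a factor.
  have hconv : ∀ n, ∑ N ∈ Finset.range n, ∑ j ∈ Finset.range N, p j * h (N - 1 - j)
      ≤ 1 / 4 * ∑ j ∈ Finset.range n, p j := by
    intro n
    rw [Finset.sum_sigma', Finset.mul_sum]
    have : ∑ x ∈ (Finset.range n).sigma fun N => Finset.range N, p x.2 * h (x.1 - 1 - x.2)
        = ∑ x ∈ (Finset.range n).sigma fun j => Finset.Ico (j + 1) n, p x.1 * h (x.2 - 1 - x.1) := by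
      refine Finset.sum_bij' (fun x _ => ⟨x.2, x.1⟩) (fun x _ => ⟨x.2, x.1⟩) ?_ ?_ ?_ ?_ ?_
      · simp only [Finset.mem_sigma, Finset.mem_range, Finset.mem_Ico]; intro x hx; omega
      · simp only [Finset.mem_sigma, Finset.mem_range, Finset.mem_Ico]; intro x hx; omega
      · simp
      · simp
      · simp
    rw [this, ← Finset.sum_sigma' (Finset.range n) (fun j => Finset.Ico (j + 1) n)
      (fun j N => p j * h (N - 1 - j))]
    refine Finset.sum_le_sum fun j _ => ?_
    rw [← Finset.mul_sum, mul_comm (1 / 4)]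
    refine mul_le_mul_of_nonneg_left ?_ (hp j)
    rw [Finset.sum_Ico_eq_sum_range]
    refine le_trans (le_of_eq ?_) ((hs.sum_le_tsum (Finset.range (n - (j + 1)))
      (fun i _ => hh i)).trans hsum)
    refine Finset.sum_congr rfl fun i _ => ?_
    congr 1; omega
  refine (summable_nat_add_iff (N₀ + W)).1 ?_
  refine summable_of_sum_range_le (c := 2 * ∑ j ∈ Finset.range (N₀ + W), p j)
    (fun n => hp _) fun n => ?_
  have h1 : ∑ i ∈ Finset.range n, p (i + (N₀ + W)) ≤
      ∑ i ∈ Finset.range n, (1 / 4 * p (i + N₀) +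
        ∑ j ∈ Finset.range (i + N₀), p j * h (i + N₀ - 1 - j)) :=
    Finset.sum_le_sum fun i _ => by
      rw [← add_assoc]; exact hrec (i + N₀) (by omega)
  have h2 : ∀ (u : ℕ → ℝ), (∀ n, 0 ≤ u n) →
      ∑ i ∈ Finset.range n, u (i + N₀) ≤ ∑ i ∈ Finset.range (n + N₀), u i := by
    intro u hu
    rw [add_comm n N₀, Finset.sum_range_add]
    simp only [add_comm _ N₀]
    exact le_add_of_nonneg_left (Finset.sum_nonneg fun i _ => hu i)
  rw [Finset.sum_add_distrib, ← Finset.mul_sum] at h1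
  have h3 := h2 p hp
  have h4 := h2 (fun N => ∑ j ∈ Finset.range N, p j * h (N - 1 - j))
    (fun N => Finset.sum_nonneg fun j _ => mul_nonneg (hp _) (hh _))
  have h5 := hconv (n + N₀)
  have h6 : ∑ i ∈ Finset.range (n + N₀), p i ≤ ∑ j ∈ Finset.range (N₀ + W), p j +
      ∑ i ∈ Finset.range n, p (i + (N₀ + W)) := by
    have := Finset.sum_range_add p (N₀ + W) n
    simp only [add_comm _ (N₀ + W)] at this ⊢
    rw [← this]
    exact Finset.sum_le_sum_of_subset_of_nonneg
      (Finset.range_mono (by omega)) fun i _ _ => hp i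
  have h7 : 0 ≤ ∑ j ∈ Finset.range (N₀ + W), p j := Finset.sum_nonneg fun i _ => hp i
  linarith

/-- One step of the bootstrap: a bound `p ≤ M * f` before time `n` improves at time `n` to
`p n ≤ (∑ p + ε + ε * M) * f n`, where `M` enters only with the small factor `ε`. -/
theorem renewal_inequality_step {f p : ℕ → ℝ} (hf : ∀ n, 0 < f n) (hfa : Antitone f)
    (hlong : ∀ k : ℕ, ∀ ρ > 1, ∀ᶠ n in atTop, f n ≤ ρ * f (n + k))
    (hconv : ∀ ε > 0, ∀ᶠ K : ℕ in atTop, ∀ᶠ n : ℕ in atTop,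
      ∑ j ∈ Finset.Ico K (n - K), f j * f (n - 1 - j) ≤ ε * f n)
    (hp : ∀ n, 0 ≤ p n)
    (hrec : ∀ ε > 0, ∃ h : ℕ → ℝ, (∀ i, 0 ≤ h i) ∧ Summable h ∧ ∑' i, h i ≤ ε ∧
      (∀ ρ > 1, ∀ᶠ i in atTop, h i ≤ ρ * f i) ∧ ∃ W > 0, ∀ᶠ N : ℕ in atTop,
        p (N + W) ≤ ε * p N + ∑ j ∈ Finset.range N, p j * h (N - 1 - j))
    (hps : Summable p) {ε : ℝ} (hε : 0 < ε) :
    ∀ᶠ n in atTop, ∀ M ≥ 0, (∀ m < n, p m ≤ M * f m) →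
      p n ≤ (∑' i, p i + ε + ε * M) * f n := by
  set S := ∑' i, p i with hS
  have hS0 : 0 ≤ S := tsum_nonneg hp
  obtain ⟨δ, hδ0, hδ1, hδ⟩ : ∃ δ > 0, δ ≤ 1 ∧ δ * (8 + S) ≤ ε :=
    ⟨min 1 (ε / (8 + S)), by positivity, min_le_left _ _, by
      calc _ ≤ ε / (8 + S) * (8 + S) := by gcongr; exact min_le_right _ _
        _ = ε := by field_simp⟩
  obtain ⟨h, hh0, hhs, hhsum, hhf, W, hW, hr⟩ := hrec δ hδ0
  obtain ⟨K, hK1, hK2⟩ := ((hconv δ hδ0).and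
    (eventually_forall_ge_atTop.2 (hhf 2 (by norm_num)))).exists
  have key : ∀ᶠ N in atTop, ∀ M ≥ 0, (∀ m < N + W, p m ≤ M * f m) →
      p (N + W) ≤ (S + ε + ε * M) * f (N + W) := by
    have hρ : 1 < 1 + δ / 3 := by linarith
    have t : ∀ k : ℕ, Tendsto (fun N : ℕ => N - k) atTop atTop := tendsto_sub_atTop_nat
    filter_upwards [hr, hK1, (t (1 + K)).eventually (eventually_forall_ge_atTop.2 (hhf _ hρ)),
      (t (1 + K)).eventually (hlong (1 + K + W) _ hρ), hlong W 2 (by norm_num),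
      (t K).eventually (hlong (K + W) 2 (by norm_num)), eventually_ge_atTop (2 * K + 2)]
      with N a1 a2 a3 a4 a5 a6 a7 M hM hpM
    have e1 : N - (1 + K) + (1 + K + W) = N + W := by omega
    have e2 : N - K + (K + W) = N + W := by omega
    rw [e1] at a4
    rw [e2] at a6
    have hfn := hf (N + W)
    have b1 : p N ≤ 2 * M * f (N + W) := by
      calc p N ≤ M * f N := hpM N (by omega)
        _ ≤ M * (2 * f (N + W)) := by gcongr
        _ = _ := by ring
    -- The convolution is split at `K` and `N - K`: `b2` yields the main term `∑ p`, `b3` is small by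
    -- subexponentiality and `b4` because `∑ h ≤ δ`.
    have b2 : ∑ j ∈ Finset.range K, p j * h (N - 1 - j) ≤ S * ((1 + δ) * f (N + W)) := by
      calc ∑ j ∈ Finset.range K, p j * h (N - 1 - j)
          ≤ ∑ j ∈ Finset.range K, p j * ((1 + δ) * f (N + W)) := by
            refine Finset.sum_le_sum fun j hj => mul_le_mul_of_nonneg_left ?_ (hp j)
            have hj' := Finset.mem_range.1 hj
            calc h (N - 1 - j) ≤ (1 + δ / 3) * f (N - 1 - j) := a3 _ (by omega)
              _ ≤ (1 + δ / 3) * ((1 + δ / 3) * f (N + W)) := by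
                gcongr
                exact (hfa (by omega)).trans a4
              _ = ((1 + δ / 3) ^ 2) * f (N + W) := by ring
              _ ≤ (1 + δ) * f (N + W) := by gcongr; nlinarith
        _ = (∑ j ∈ Finset.range K, p j) * ((1 + δ) * f (N + W)) := by rw [Finset.sum_mul]
        _ ≤ _ := by
          gcongr
          exact hps.sum_le_tsum _ fun i _ => hp i
    have b3 : ∑ j ∈ Finset.Ico K (N - K), p j * h (N - 1 - j) ≤ 4 * δ * M * f (N + W) := by
      calc ∑ j ∈ Finset.Ico K (N - K), p j * h (N - 1 - j)
          ≤ ∑ j ∈ Finset.Ico K (N - K), 2 * M * (f j * f (N - 1 - j)) := by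
            refine Finset.sum_le_sum fun j hj => ?_
            have hj' := Finset.mem_Ico.1 hj
            calc p j * h (N - 1 - j) ≤ (M * f j) * (2 * f (N - 1 - j)) := by
                  have := (hf j).le
                  exact mul_le_mul (hpM j (by omega)) (hK2 _ (by omega)) (hh0 _) (by positivity)
              _ = _ := by ring
        _ = 2 * M * ∑ j ∈ Finset.Ico K (N - K), f j * f (N - 1 - j) := by rw [Finset.mul_sum]
        _ ≤ 2 * M * (δ * (2 * f (N + W))) := by
            gcongr
            exact a2.trans (by gcongr)
        _ = _ := by ring
    have b4 : ∑ j ∈ Finset.Ico (N - K) N, p j * h (N - 1 - j) ≤ 2 * δ * M * f (N + W) := by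
      calc ∑ j ∈ Finset.Ico (N - K) N, p j * h (N - 1 - j)
          ≤ ∑ j ∈ Finset.Ico (N - K) N, (M * (2 * f (N + W))) * h (N - 1 - j) := by
            refine Finset.sum_le_sum fun j hj => mul_le_mul_of_nonneg_right ?_ (hh0 _)
            have hj' := Finset.mem_Ico.1 hj
            refine (hpM j (by omega)).trans ?_
            gcongr
            exact (hfa hj'.1).trans a6
        _ = (M * (2 * f (N + W))) * ∑ j ∈ Finset.Ico (N - K) N, h (N - 1 - j) := by
            rw [Finset.mul_sum]
        _ ≤ (M * (2 * f (N + W))) * δ := by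
            gcongr
            refine le_trans (le_of_eq ?_) ((hhs.sum_le_tsum (Finset.range K)
              (fun i _ => hh0 i)).trans hhsum)
            refine Finset.sum_bij' (fun j _ => N - 1 - j) (fun j _ => N - 1 - j) ?_ ?_ ?_ ?_ ?_
            all_goals simp only [Finset.mem_range, Finset.mem_Ico]
            all_goals intro i hi
            all_goals first | rfl | omega | trivial
        _ = _ := by ring
    have hsplit : ∑ j ∈ Finset.range N, p j * h (N - 1 - j) =
        ∑ j ∈ Finset.range K, p j * h (N - 1 - j) +
        ∑ j ∈ Finset.Ico K (N - K), p j * h (N - 1 - j) +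
        ∑ j ∈ Finset.Ico (N - K) N, p j * h (N - 1 - j) := by
      simp only [Finset.range_eq_Ico]
      rw [Finset.sum_Ico_consecutive _ (by omega) (by omega),
        Finset.sum_Ico_consecutive _ (by omega) (by omega)]
    calc p (N + W) ≤ δ * (2 * M * f (N + W)) + (S * ((1 + δ) * f (N + W)) +
          4 * δ * M * f (N + W) + 2 * δ * M * f (N + W)) := by
          rw [hsplit] at a1
          have := mul_le_mul_of_nonneg_left b1 hδ0.le
          linarith
      _ = (S + δ * S + 8 * δ * M) * f (N + W) := by ring
      _ ≤ (S + ε + ε * M) * f (N + W) := by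
          have : δ * S ≤ ε := by linarith
          have : 8 * δ ≤ ε := by nlinarith
          gcongr
  obtain ⟨N₀, hN₀⟩ := eventually_atTop.1 key
  filter_upwards [eventually_ge_atTop (N₀ + W)] with n hn
  have := hN₀ (n - W) (by omega)
  rwa [Nat.sub_add_cancel (by omega)] at this

/-- The step lemma is used twice: with `ε = 1 / 2` it shows by induction that `p / f` is bounded by
some `M`, and with `ε` small and this `M` fixed it gives the sharp constant `∑ p`. -/
theorem renewal_inequality {f p : ℕ → ℝ} (hf : ∀ n, 0 < f n) (hfa : Antitone f)
    (hlong : ∀ k : ℕ, ∀ ρ > 1, ∀ᶠ n in atTop, f n ≤ ρ * f (n + k))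
    (hconv : ∀ ε > 0, ∀ᶠ K : ℕ in atTop, ∀ᶠ n : ℕ in atTop,
      ∑ j ∈ Finset.Ico K (n - K), f j * f (n - 1 - j) ≤ ε * f n)
    (hp : ∀ n, 0 ≤ p n)
    (hrec : ∀ ε > 0, ∃ h : ℕ → ℝ, (∀ i, 0 ≤ h i) ∧ Summable h ∧ ∑' i, h i ≤ ε ∧
      (∀ ρ > 1, ∀ᶠ i in atTop, h i ≤ ρ * f i) ∧ ∃ W > 0, ∀ᶠ N : ℕ in atTop,
        p (N + W) ≤ ε * p N + ∑ j ∈ Finset.range N, p j * h (N - 1 - j)) :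
    Summable p ∧ ∀ ε > 0, ∀ᶠ n in atTop, p n ≤ (∑' i, p i + ε) * f n := by
  have hps : Summable p := by
    obtain ⟨h, hh0, hhs, hhsum, -, W, -, hr⟩ := hrec (1 / 4) (by norm_num)
    obtain ⟨N₀, hN₀⟩ := eventually_atTop.1 hr
    exact summable_of_renewal_inequality hp hh0 hhs hhsum hN₀
  refine ⟨hps, ?_⟩
  have hstep := fun (ε : ℝ) (hε : 0 < ε) =>
    renewal_inequality_step hf hfa hlong hconv hp hrec hps hε
  set S := ∑' i, p i with hS
  have hS0 : 0 ≤ S := tsum_nonneg hp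
  obtain ⟨M, hM0, hM⟩ : ∃ M ≥ 0, ∀ n, p n ≤ M * f n := by
    obtain ⟨n₀, hn₀⟩ := eventually_atTop.1 (hstep (1 / 2) (by norm_num))
    set M := 2 * S + 1 + ∑ m ∈ Finset.range n₀, p m / f m with hMdef
    have hpos : ∀ m, 0 ≤ p m / f m := fun m => div_nonneg (hp m) (hf m).le
    have hM2 : 2 * S + 1 ≤ M := le_add_of_nonneg_right (Finset.sum_nonneg fun m _ => hpos m)
    refine ⟨M, by linarith, fun n => ?_⟩
    induction n using Nat.strong_induction_on with
    | _ n ih =>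
      rcases lt_or_ge n n₀ with hn | hn
      · rw [← div_le_iff₀ (hf n)]
        have := Finset.single_le_sum (f := fun m => p m / f m) (fun m _ => hpos m)
          (Finset.mem_range.2 hn)
        linarith
      · refine (hn₀ n hn M (by linarith) ih).trans ?_
        have := (hf n).le
        gcongr
        linarith
  intro ε hε
  filter_upwards [hstep (ε / (1 + M)) (by positivity)] with n hn
  refine (hn M hM0 fun m _ => hM m).trans (le_of_eq ?_)
  field_simp
  ring

/-! ### Tails that are insensitive to logarithmic shifts -/

/-- Iterating `F (y - log y) ~ F y`: each application at `y - c * log y ≥ √y` gains a further shift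
of at least `log y / 2`. -/
theorem eventually_tail_sub_log_mul_le {F : ℝ → ℝ} (hF : ∀ y, 0 < F y) (hanti : Antitone F)
    (hlog : F ~[atTop] fun y => F (y - Real.log y)) (C : ℝ) :
    ∀ ρ > 1, ∀ᶠ y in atTop, F (y - C * Real.log y) ≤ ρ * F y := by
  have hlo : ∀ c : ℝ, ∀ b : ℝ, 0 < b → ∀ᶠ y : ℝ in atTop, c * Real.log y ≤ b * y := by
    intro c b hb
    have := (Real.isLittleO_log_id_atTop.const_mul_left c).def hb
    filter_upwards [this, eventually_gt_atTop 0] with y hy hy0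
    simp only [id, Real.norm_eq_abs, abs_of_pos hy0] at hy
    exact (le_abs_self _).trans hy
  have h1 : ∀ ρ > 1, ∀ᶠ y in atTop, F (y - Real.log y) ≤ ρ * F y := by
    intro ρ hρ
    have ht := (isEquivalent_iff_tendsto_one
      (Eventually.of_forall fun y => (hF y).ne')).1 hlog.symm
    filter_upwards [ht.eventually_le_const hρ] with y hy
    exact (div_le_iff₀ (hF y)).1 hy
  have h2 : ∀ k : ℕ, ∀ ρ > 1, ∀ᶠ y in atTop,
      F (y - (k : ℝ) / 2 * Real.log y) ≤ ρ * F y := by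
    intro k
    induction k with
    | zero =>
      intro ρ hρ
      refine Eventually.of_forall fun y => ?_
      simpa using le_mul_of_one_le_left (hF y).le hρ.le
    | succ k ih =>
      intro ρ hρ
      obtain ⟨σ, hσ1, hσ⟩ : ∃ σ > 1, σ * σ = ρ :=
        ⟨√ρ, by rwa [gt_iff_lt, Real.lt_sqrt zero_le_one, one_pow],
          Real.mul_self_sqrt (by linarith)⟩
      have ht : Tendsto (fun y : ℝ => y - (k : ℝ) / 2 * Real.log y) atTop atTop := by
        refine tendsto_atTop_mono' atTop ?_ (tendsto_id.atTop_mul_const (by norm_num : (0:ℝ) < 1 / 2))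
        filter_upwards [hlo ((k : ℝ) / 2) (1 / 2) (by norm_num)] with y hy
        simp only [id]; linarith
      filter_upwards [ih σ hσ1, ht.eventually (h1 σ hσ1), hlo ((k : ℝ) / 2) (1 / 2) (by norm_num),
        eventually_ge_atTop 4] with y a1 a2 a3 a4
      have hy : √y ≤ y - (k : ℝ) / 2 * Real.log y := by
        have : 2 * √y ≤ √y * √y := by
          gcongr
          exact Real.le_sqrt_of_sq_le (by linarith)
        rw [Real.mul_self_sqrt (by linarith)] at this
        linarith
      have hl : 1 / 2 * Real.log y ≤ Real.log (y - (k : ℝ) / 2 * Real.log y) := by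
        have := Real.log_le_log (Real.sqrt_pos.2 (by linarith)) hy
        rw [Real.log_sqrt (by linarith)] at this
        linarith
      calc F (y - ((k + 1 : ℕ) : ℝ) / 2 * Real.log y)
          ≤ F (y - (k : ℝ) / 2 * Real.log y - Real.log (y - (k : ℝ) / 2 * Real.log y)) := by
            apply hanti
            push_cast
            linarith
        _ ≤ σ * F (y - (k : ℝ) / 2 * Real.log y) := a2
        _ ≤ σ * (σ * F y) := by gcongr
        _ = ρ * F y := by rw [← hσ]; ring
  intro ρ hρ
  obtain ⟨k, hk⟩ := exists_nat_ge (2 * C)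
  filter_upwards [h2 k ρ hρ, eventually_ge_atTop 1] with y hy hy1
  refine (hanti ?_).trans hy
  have := Real.log_nonneg hy1
  have : C * Real.log y ≤ k / 2 * Real.log y := by gcongr; linarith
  linarith

theorem eventually_tail_le_mul_tail_add {F : ℝ → ℝ} (hF : ∀ y, 0 < F y) (hanti : Antitone F)
    (hlog : F ~[atTop] fun y => F (y - Real.log y)) (c : ℝ) :
    ∀ ρ > 1, ∀ᶠ y in atTop, F y ≤ ρ * F (y + c) := by
  intro ρ hρ
  have ht : Tendsto (fun y : ℝ => y + c) atTop atTop := tendsto_atTop_add_const_right _ _ tendsto_id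
  filter_upwards [ht.eventually (eventually_tail_sub_log_mul_le hF hanti hlog 1 ρ hρ),
    (Real.tendsto_log_atTop.comp ht).eventually_ge_atTop c] with y h1 h2
  refine (hanti ?_).trans h1
  simp only [Function.comp] at h2
  linarith

theorem summable_tail {F : ℝ → ℝ} (hF : ∀ y, 0 < F y) (hanti : Antitone F)
    (hint : IntegrableOn F (Set.Ioi 0)) : Summable fun n : ℕ => F n := by
  refine (summable_nat_add_iff 1).1 (summable_of_sum_range_le (c := ∫ y in Set.Ioi 0, F y)
    (fun n => (hF _).le) fun n => ?_)
  have h := (hanti.antitoneOn (Set.Icc (0 : ℝ) (0 + (n : ℕ)))).sum_le_integral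
  simp only [zero_add] at h
  refine h.trans ?_
  rw [intervalIntegral.integral_of_le (by positivity)]
  exact setIntegral_mono_set hint (Eventually.of_forall fun y => (hF y).le)
    (Set.Ioc_subset_Ioi_self).eventuallyLE

/-- Discrete form of strong subexponentiality. The two ends of the convolution integral contribute
at least `2 * F x * ∫₀^K F`, which almost exhausts the limit `2 * F x * ∫₀^∞ F`, so little is left for
the middle; by monotonicity the sum is at most the integral at `x = n - 2`. -/
theorem eventually_convolution_middle_le {F : ℝ → ℝ} (hF : ∀ y, 0 < F y) (hanti : Antitone F)
    (hlog : F ~[atTop] fun y => F (y - Real.log y))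
    (hint : IntegrableOn F (Set.Ioi 0))
    (hconv : Tendsto (fun x => (∫ y in (0 : ℝ)..x, F (x - y) * F y) / F x) atTop
      (𝓝 (2 * ∫ y in Set.Ioi (0 : ℝ), F y))) {ε : ℝ} (hε : 0 < ε) :
    ∀ᶠ K : ℕ in atTop, ∀ᶠ n : ℕ in atTop,
      ∑ j ∈ Finset.Ico K (n - K), F j * F ((n - 1 - j : ℕ) : ℝ) ≤ ε * F n := by
  set μ := ∫ y in Set.Ioi (0 : ℝ), F y with hμ
  have hI : ∀ x a b : ℝ, IntervalIntegrable (fun y => F (x - y) * F y) volume a b := by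
    intro x a b
    have hm : Measurable (fun y => F (x - y) * F y) :=
      (hanti.measurable.comp (measurable_const.sub measurable_id)).mul hanti.measurable
    refine (intervalIntegrable_const (c := F (x - max a b) * F (min a b))).mono_fun
      hm.aestronglyMeasurable ?_
    refine (ae_restrict_iff' measurableSet_uIoc).2 (Eventually.of_forall fun y hy => ?_)
    rw [Set.uIoc, Set.mem_Ioc] at hy
    change ‖F (x - y) * F y‖ ≤ ‖F (x - max a b) * F (min a b)‖
    rw [Real.norm_of_nonneg (mul_pos (hF _) (hF _)).le,
      Real.norm_of_nonneg (mul_pos (hF _) (hF _)).le]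
    exact mul_le_mul (hanti (by linarith)) (hanti hy.1.le) (hF _).le (hF _).le
  have hFI : ∀ a b : ℝ, IntervalIntegrable F volume a b := fun a b => hanti.intervalIntegrable
  have hlim : Tendsto (fun x : ℝ => ∫ y in (0 : ℝ)..x, F y) atTop (𝓝 μ) :=
    intervalIntegral_tendsto_integral_Ioi 0 hint tendsto_id
  have hlimK : Tendsto (fun K : ℕ => ∫ y in (0 : ℝ)..((K : ℝ) - 1), F y) atTop (𝓝 μ) :=
    hlim.comp (tendsto_atTop_add_const_right _ (-1) tendsto_natCast_atTop_atTop)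
  filter_upwards [hlimK.eventually_const_le (show μ - ε / 8 < μ by linarith),
    eventually_ge_atTop 1] with K hK hK1
  have hK1' : (1 : ℝ) ≤ K := by exact_mod_cast hK1
  have tn : Tendsto (fun n : ℕ => (n : ℝ) - 2) atTop atTop :=
    tendsto_atTop_add_const_right _ (-2) tendsto_natCast_atTop_atTop
  filter_upwards [tn.eventually (hconv.eventually_le_const
      (show 2 * μ < 2 * μ + ε / 4 by linarith)),
    tn.eventually (eventually_tail_le_mul_tail_add hF hanti hlog 2 2 (by norm_num)),
    eventually_ge_atTop (2 * K + 2)] with n h1 h2 h3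
  have hn : (2 * K + 2 : ℝ) ≤ n := by exact_mod_cast h3
  rw [div_le_iff₀ (hF _)] at h1
  simp only [sub_add_cancel] at h2
  set x : ℝ := (n : ℝ) - 2 with hx
  set c : ℝ := (K : ℝ) - 1 with hc
  have hleft : F x * ∫ y in (0 : ℝ)..c, F y ≤ ∫ y in (0 : ℝ)..c, F (x - y) * F y := by
    rw [← intervalIntegral.integral_const_mul]
    refine intervalIntegral.integral_mono_on (by linarith) ((hFI _ _).const_mul _) (hI _ _ _)
      fun y hy => ?_
    exact mul_le_mul_of_nonneg_right (hanti (by linarith [hy.1])) (hF y).le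
  -- Symmetric to `hleft` under `y ↦ x - y`.
  have hright : F x * ∫ y in (0 : ℝ)..c, F y ≤ ∫ y in (x - c)..x, F (x - y) * F y := by
    have : ∫ y in (x - c)..x, F (x - y) * F y = ∫ y in (0 : ℝ)..c, F (x - y) * F y := by
      have := intervalIntegral.integral_comp_sub_left (a := (0 : ℝ)) (b := c)
        (fun y => F (x - y) * F y) x
      simp only [sub_zero, sub_sub_cancel] at this
      rw [← this]
      exact intervalIntegral.integral_congr fun y _ => mul_comm _ _
    rw [this]; exact hleft
  have hsplit : (∫ y in (0 : ℝ)..c, F (x - y) * F y) + (∫ y in c..(x - c), F (x - y) * F y) +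
      (∫ y in (x - c)..x, F (x - y) * F y) = ∫ y in (0 : ℝ)..x, F (x - y) * F y := by
    rw [intervalIntegral.integral_add_adjacent_intervals (hI _ _ _) (hI _ _ _),
      intervalIntegral.integral_add_adjacent_intervals (hI _ _ _) (hI _ _ _)]
  have hmid : ∫ y in c..(x - c), F (x - y) * F y ≤ ε / 2 * F x := by
    have := mul_le_mul_of_nonneg_left hK (hF x).le
    nlinarith [hF x]
  have hsum : ∑ j ∈ Finset.Ico K (n - K), F j * F ((n - 1 - j : ℕ) : ℝ) ≤
      ∫ y in c..(x - c), F (x - y) * F y := by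
    have e : ∫ y in c..(x - c), F (x - y) * F y =
        ∑ j ∈ Finset.Ico K (n - K), ∫ y in ((j : ℝ) - 1)..(((j + 1 : ℕ) : ℝ) - 1),
          F (x - y) * F y := by
      rw [intervalIntegral.sum_integral_adjacent_intervals_Ico (a := fun j : ℕ => (j : ℝ) - 1)
        (by omega) fun k _ => hI _ _ _]
      congr 1
      rw [Nat.cast_sub (by omega)]
      rw [hx, hc]; ring
    rw [e]
    refine Finset.sum_le_sum fun j hj => ?_
    have hj := Finset.mem_Ico.1 hj
    have e2 : ((n - 1 - j : ℕ) : ℝ) = n - 1 - j := by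
      rw [Nat.cast_sub (by omega), Nat.cast_sub (by omega)]; simp
    have : ∫ y in ((j : ℝ) - 1)..(((j + 1 : ℕ) : ℝ) - 1), F j * F ((n - 1 - j : ℕ) : ℝ) =
        F j * F ((n - 1 - j : ℕ) : ℝ) := by
      rw [intervalIntegral.integral_const]; simp
    rw [← this]
    -- On `[j - 1, j]` both `y ≤ j` and `x - y ≤ n - 1 - j`, as `x = n - 2`.
    refine intervalIntegral.integral_mono_on (by push_cast; linarith) (by simp) (hI _ _ _)
      fun y hy => ?_
    have hy1 := hy.1
    have hy2 := hy.2
    push_cast at hy2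
    rw [mul_comm]
    refine mul_le_mul (hanti ?_) (hanti (by linarith)) (hF _).le (hF _).le
    rw [e2, hx]; linarith
  have := mul_le_mul_of_nonneg_left h2 hε.le
  linarith

/-! ### The tail of a weighted innovation -/

section

variable {Ω : Type*} [MeasurableSpace Ω]

theorem tendsto_measureReal_lt_atTop (P : Measure Ω) [IsProbabilityMeasure P] {X : Ω → ℝ}
    (hX : Measurable X) : Tendsto (fun y => P.real {ω | y < X ω}) atTop (𝓝 0) := by
  have := Measure.isProbabilityMeasure_map (μ := P) hX.aemeasurable
  have h : ∀ y, P.real {ω | y < X ω} = 1 - cdf (P.map X) y := by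
    intro y
    rw [cdf_eq_real, map_measureReal_apply hX measurableSet_Iic,
      ← probReal_compl_eq_one_sub (hX measurableSet_Iic)]
    congr 1
    ext ω
    simp
  simp only [h]
  simpa using (tendsto_cdf_atTop (P.map X)).const_sub 1

/-- The probability that `a ^ i * X` exceeds the share `1 / ((i + 1) * (i + 2))` of the level `y`.
The shares sum to one over all `i`, and their polynomial decay shifts the level of `log X` by
`O(log i)` only. -/
def jumpTail (P : Measure Ω) (a : ℝ) (X : Ω → ℝ) (y : ℝ) (i : ℕ) : ℝ :=
  P.real {ω | y / (a ^ i * ((i + 1) * (i + 2))) < X ω}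

theorem jumpTail_nonneg (P : Measure Ω) (a : ℝ) (X : Ω → ℝ) (y : ℝ) (i : ℕ) :
    0 ≤ jumpTail P a X y i :=
  measureReal_nonneg

/-- For fixed `y` the level, in units of `log a⁻¹`, is `i - O(log i)`. -/
theorem eventually_jumpTail_le (P : Measure Ω) [IsProbabilityMeasure P] {a : ℝ} (ha₀ : 0 < a)
    (ha₁ : a < 1) {X η : Ω → ℝ} (hη : ∀ ω, η ω = Real.logb a⁻¹ (X ω))
    (hpos : ∀ y, 0 < P.real {ω | y < η ω})
    (hlog : (fun y : ℝ => P.real {ω | y < η ω}) ~[atTop]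
      fun y : ℝ => P.real {ω | y - Real.log y < η ω}) {y : ℝ} (hy : 0 < y) :
    ∀ ρ > 1, ∀ᶠ i : ℕ in atTop, jumpTail P a X y i ≤ ρ * P.real {ω | (i : ℝ) < η ω} := by
  intro ρ hρ
  have hanti : Antitone fun y : ℝ => P.real {ω | y < η ω} := fun s t hst =>
    measureReal_mono fun ω (h : t < η ω) => hst.trans_lt h
  have hA : 0 < Real.log a⁻¹ := Real.log_pos ((one_lt_inv₀ ha₀).2 ha₁)
  have h1 := eventually_tail_sub_log_mul_le hpos hanti hlog (3 / Real.log a⁻¹) ρ hρ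
  filter_upwards [tendsto_natCast_atTop_atTop.eventually h1, eventually_ge_atTop 1,
    tendsto_natCast_atTop_atTop.eventually (eventually_ge_atTop (6 / y))] with i hi hi1 hi2
  have hi1' : (1 : ℝ) ≤ i := by exact_mod_cast hi1
  refine le_trans (measureReal_mono fun ω hω => ?_) hi
  simp only [Set.mem_ofPred_eq] at hω ⊢
  have ht : 0 < y / (a ^ i * ((i + 1) * (i + 2))) := by positivity
  rw [hη]
  refine lt_of_le_of_lt ?_ (Real.logb_lt_logb ((one_lt_inv₀ ha₀).2 ha₁) ht hω)
  rw [Real.logb, le_div_iff₀ hA, Real.log_div hy.ne' (by positivity),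
    Real.log_mul (by positivity) (by positivity), Real.log_pow]
  have hw : Real.log (((i : ℝ) + 1) * (i + 2)) ≤ Real.log y + 3 * Real.log i := by
    have h3 : Real.log y + 3 * Real.log i = Real.log (y * (i : ℝ) ^ 3) := by
      rw [Real.log_mul hy.ne' (by positivity), Real.log_pow]; norm_num
    rw [h3]
    refine Real.log_le_log (by positivity) ?_
    rw [div_le_iff₀ hy] at hi2
    calc ((i : ℝ) + 1) * (i + 2) ≤ 6 * i ^ 2 := by nlinarith
      _ ≤ (i * y) * i ^ 2 := by gcongr
      _ = y * i ^ 3 := by ring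
  have e : ((i : ℝ) - 3 / Real.log a⁻¹ * Real.log i) * Real.log a⁻¹ =
      i * Real.log a⁻¹ - 3 * Real.log i := by
    rw [sub_mul, mul_right_comm, div_mul_cancel₀ _ hA.ne']
  rw [e, Real.log_inv]
  linarith

theorem summable_jumpTail (P : Measure Ω) [IsProbabilityMeasure P] {a : ℝ} (ha₀ : 0 < a)
    (ha₁ : a < 1) {X η : Ω → ℝ} (hη : ∀ ω, η ω = Real.logb a⁻¹ (X ω))
    (hpos : ∀ y, 0 < P.real {ω | y < η ω})
    (hlog : (fun y : ℝ => P.real {ω | y < η ω}) ~[atTop]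
      fun y : ℝ => P.real {ω | y - Real.log y < η ω})
    (hs : Summable fun i : ℕ => P.real {ω | (i : ℝ) < η ω}) {y : ℝ} (hy : 0 < y) :
    Summable (jumpTail P a X y) := by
  refine summable_of_isBigO_nat hs (IsBigO.of_bound 2 ?_)
  filter_upwards [eventually_jumpTail_le P ha₀ ha₁ hη hpos hlog hy 2 (by norm_num)] with i hi
  rwa [Real.norm_of_nonneg (jumpTail_nonneg ..), Real.norm_of_nonneg measureReal_nonneg]

theorem tendsto_tsum_jumpTail (P : Measure Ω) [IsProbabilityMeasure P] {a : ℝ} (ha₀ : 0 < a)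
    {X : Ω → ℝ} (hX : Measurable X)
    (hs : ∀ y > 0, Summable (jumpTail P a X y)) :
    Tendsto (fun y => ∑' i, jumpTail P a X y i) atTop (𝓝 0) := by
  have h := tendsto_tsum_of_dominated_convergence (𝓕 := atTop)
    (f := fun y i => jumpTail P a X y i) (g := fun _ => (0 : ℝ)) (hs 1 one_pos)
    (fun i => ?_) ?_
  · simpa using h
  · exact (tendsto_measureReal_lt_atTop P hX).comp
      (tendsto_id.atTop_div_const (by positivity))
  · filter_upwards [eventually_ge_atTop 1] with y hy i
    rw [Real.norm_of_nonneg (jumpTail_nonneg ..)]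
    refine measureReal_mono fun ω hω => ?_
    simp only [Set.mem_ofPred_eq] at hω ⊢
    refine lt_of_le_of_lt ?_ hω
    gcongr

end

/-! ### Pathwise properties of the chain -/

section

variable {Ω : Type*} {a : ℝ} {ξ : ℕ → Ω → ℝ}

theorem arChain_eq_sum (a : ℝ) (ξ : ℕ → Ω → ℝ) (x : ℝ) (n : ℕ) (ω : Ω) :
    arChain a ξ x n ω = a ^ n * x + ∑ k ∈ Finset.range n, a ^ (n - 1 - k) * ξ k ω := by
  induction n with
  | zero => simp [arChain]
  | succ n ih =>
    simp only [arChain]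
    rw [ih, Finset.sum_range_succ, mul_add, Finset.mul_sum]
    have : ∑ k ∈ Finset.range n, a * (a ^ (n - 1 - k) * ξ k ω) =
        ∑ k ∈ Finset.range n, a ^ (n + 1 - 1 - k) * ξ k ω := by
      refine Finset.sum_congr rfl fun k hk => ?_
      have := Finset.mem_range.1 hk
      rw [← mul_assoc, ← pow_succ']
      congr 2; omega
    rw [this]
    simp [pow_succ]; ring

/-- Restarting at time `m`: the shifted chain starts from `0` and uses only the innovations from
`ξ m` on. -/
theorem arChain_add (a : ℝ) (ξ : ℕ → Ω → ℝ) (x : ℝ) (m n : ℕ) (ω : Ω) :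
    arChain a ξ x (m + n) ω =
      a ^ n * arChain a ξ x m ω + arChain a (fun k => ξ (m + k)) 0 n ω := by
  induction n with
  | zero => simp [arChain]
  | succ n ih =>
    rw [← add_assoc]
    simp only [arChain]
    rw [ih]
    ring

theorem sum_inv_succ_mul_succ_le_one (n : ℕ) :
    ∑ i ∈ Finset.range n, (1 : ℝ) / (((i : ℝ) + 1) * (i + 2)) ≤ 1 := by
  have : ∑ i ∈ Finset.range n, (1 : ℝ) / (((i : ℝ) + 1) * (i + 2)) = 1 - 1 / ((n : ℝ) + 1) := by
    induction n with
    | zero => simp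
    | succ n ih => rw [Finset.sum_range_succ, ih]; push_cast; field_simp; ring
  rw [this]
  have : (0 : ℝ) ≤ 1 / ((n : ℝ) + 1) := by positivity
  linarith

/-- If the chain exceeds the contribution of its starting point by `y`, then some innovation exceeds
its share of `y`. -/
theorem exists_large_innovation (ha₀ : 0 < a) {x y : ℝ} (hy : 0 < y) {n : ℕ} {ω : Ω}
    (h : a ^ n * x + y < arChain a ξ x n ω) :
    ∃ k < n, y / (a ^ (n - 1 - k) * (((n - 1 - k : ℕ) + 1) * ((n - 1 - k : ℕ) + 2))) < ξ k ω := by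
  by_contra! hc
  rw [arChain_eq_sum] at h
  have h1 : ∑ k ∈ Finset.range n, a ^ (n - 1 - k) * ξ k ω ≤
      ∑ k ∈ Finset.range n, y * (1 / ((((n - 1 - k : ℕ) : ℝ) + 1) * ((n - 1 - k : ℕ) + 2))) := by
    refine Finset.sum_le_sum fun k hk => ?_
    have := mul_le_mul_of_nonneg_left (hc k (Finset.mem_range.1 hk)) (pow_pos ha₀ (n - 1 - k)).le
    refine this.trans (le_of_eq ?_)
    have := pow_pos ha₀ (n - 1 - k)
    field_simp
  rw [Finset.sum_range_reflect
    (fun i : ℕ => y * (1 / (((i : ℝ) + 1) * ((i : ℝ) + 2)))) n, ← Finset.mul_sum] at h1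
  have := mul_le_mul_of_nonneg_left (sum_inv_succ_mul_succ_le_one n) hy.le
  linarith
end

/-! ### Survival probabilities: the recursive upper bound -/

section

variable {Ω : Type*}

/-- The σ-algebra generated by the innovations `ξ k` with `k ∈ S`. -/
abbrev innovationSigma (ξ : ℕ → Ω → ℝ) (S : Set ℕ) : MeasurableSpace Ω :=
  ⨆ k ∈ S, MeasurableSpace.comap (ξ k) inferInstance

/-- The event `T > n` that the chain stays above `x₀` at the times `1, …, n`. -/
def survivalSet (a : ℝ) (ξ : ℕ → Ω → ℝ) (x₀ x : ℝ) (n : ℕ) : Set Ω :=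
  {ω | ∀ k, 1 ≤ k → k ≤ n → x₀ < arChain a ξ x k ω}

theorem survivalSet_anti (a : ℝ) (ξ : ℕ → Ω → ℝ) (x₀ x : ℝ) :
    Antitone (survivalSet a ξ x₀ x) :=
  fun _ _ hmn _ h k hk hkm => h k hk (hkm.trans hmn)

theorem innovation_measurable {ξ : ℕ → Ω → ℝ} {S : Set ℕ} {k : ℕ} (hk : k ∈ S) :
    Measurable[innovationSigma ξ S] (ξ k) :=
  (comap_measurable (ξ k)).mono (le_iSup₂_of_le k hk le_rfl) le_rfl

theorem arChain_measurable {m : MeasurableSpace Ω} (a : ℝ) {ξ : ℕ → Ω → ℝ} (x : ℝ) {n : ℕ}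
    (h : ∀ k < n, Measurable (ξ k)) : Measurable (arChain a ξ x n) := by
  induction n with
  | zero => exact measurable_const
  | succ n ih =>
    exact ((ih fun k hk => h k (by omega)).const_mul a).add (h n (by omega))

theorem survivalSet_measurableSet {m : MeasurableSpace Ω} (a : ℝ) {ξ : ℕ → Ω → ℝ} (x₀ x : ℝ)
    {n : ℕ} (h : ∀ k < n, Measurable (ξ k)) : MeasurableSet (survivalSet a ξ x₀ x n) := by
  have : survivalSet a ξ x₀ x n =
      ⋂ k, ⋂ (_ : 1 ≤ k), ⋂ (_ : k ≤ n), {ω | x₀ < arChain a ξ x k ω} := by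
    ext; simp [survivalSet]
  rw [this]
  exact .iInter fun k => .iInter fun _ => .iInter fun hk =>
    measurableSet_lt measurable_const (arChain_measurable a x fun j hj => h j (by omega))

variable {a : ℝ} {ξ : ℕ → Ω → ℝ}

theorem shifted_arChain_measurable (a : ℝ) {s n : ℕ} {S : Set ℕ}
    (hS : ∀ k, s ≤ k → k < s + n → k ∈ S) :
    Measurable[innovationSigma ξ S] (arChain a (fun k => ξ (s + k)) 0 n) :=
  arChain_measurable (m := innovationSigma ξ S) a 0 fun k hk =>
    innovation_measurable (hS _ (by omega) (by omega))

theorem arChain_le_of_innovation_le (ha₀ : 0 < a) (ha₁ : a < 1) {b : ℝ} {s n : ℕ} {ω : Ω}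
    (h : ∀ k, s ≤ k → k < s + n → ξ k ω ≤ b) (hb : 0 ≤ b) :
    arChain a (fun k => ξ (s + k)) 0 n ω ≤ b / (1 - a) := by
  have h1 : 0 < 1 - a := by linarith
  induction n with
  | zero => simp only [arChain]; positivity
  | succ n ih =>
    have h2 := ih fun k hk hk2 => h k hk (by omega)
    have h3 := h (s + n) (by omega) (by omega)
    simp only [arChain]
    calc _ ≤ a * (b / (1 - a)) + b := by gcongr
      _ = _ := by field_simp; ring

/-- If the chain survives all `r` blocks of length `B` after time `N`, then either all chains
restarted from `0` at the block starts end above `x₁`, or the chain is above `3 * y` at some block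
start; in the latter case the chain restarted at time `N` exceeds `y` there, or `X_N > 2 * y`. -/
theorem survivalSet_subset_blocks (ha₀ : 0 < a) (ha₁ : a < 1) {x₀ x x₁ y : ℝ} {B : ℕ}
    (hB : 0 < B) (hy : 0 < y)
    (hx₁ : a ^ B * (4 * y) ≤ x₀ - x₁) (N r : ℕ) :
    survivalSet a ξ x₀ x (N + r * B) ⊆
      (survivalSet a ξ x₀ x N ∩
        {ω | ∀ i < r, x₁ < arChain a (fun k => ξ (N + i * B + k)) 0 B ω}) ∪
      ((⋃ i ∈ Finset.range r, survivalSet a ξ x₀ x N ∩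
        {ω | y < arChain a (fun k => ξ (N + k)) 0 (i * B) ω}) ∪
      (survivalSet a ξ x₀ x N ∩ {ω | 2 * y < arChain a ξ x N ω})) := by
  intro ω hω
  have hN : ω ∈ survivalSet a ξ x₀ x N := survivalSet_anti a ξ x₀ x (Nat.le_add_right _ _) hω
  by_contra hc
  simp only [Set.mem_union, Set.mem_inter_iff, Set.mem_iUnion, hN, true_and, not_or,
    Set.mem_ofPred_eq, not_lt, not_forall, not_exists, Finset.mem_range, exists_prop] at hc
  obtain ⟨⟨i, hi, h1⟩, h2, h3⟩ := hc
  have h2 := not_lt.1 fun h => h2 i ⟨hi, h⟩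
  have h4 : x₀ < arChain a ξ x (N + i * B + B) ω := by
    refine hω _ (by omega) ?_
    have : (i + 1) * B ≤ r * B := Nat.mul_le_mul_right _ hi
    rw [add_mul] at this
    omega
  rw [arChain_add] at h4
  -- At the block start `X_N` still contributes at most `2 * y`, and the rest at most `y`.
  have h5 : arChain a ξ x (N + i * B) ω ≤ 3 * y := by
    rw [arChain_add]
    have h6 : a ^ (i * B) ≤ 1 := pow_le_one₀ ha₀.le ha₁.le
    have h7 : 0 < a ^ (i * B) := pow_pos ha₀ _
    nlinarith
  have h8 : 0 < a ^ B := pow_pos ha₀ _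
  nlinarith

variable [MeasurableSpace Ω] {P : Measure Ω}

theorem innovationSigma_le (hξ : ∀ n, Measurable (ξ n)) (S : Set ℕ) :
    innovationSigma ξ S ≤ ‹MeasurableSpace Ω› :=
  iSup₂_le fun k _ => (hξ k).comap_le

theorem measureReal_inter_of_disjoint [IsProbabilityMeasure P] (hξ : ∀ n, Measurable (ξ n))
    (hind : iIndepFun ξ P)
    {S T : Set ℕ} (hST : Disjoint S T) {A B : Set Ω} (hA : MeasurableSet[innovationSigma ξ S] A)
    (hB : MeasurableSet[innovationSigma ξ T] B) : P.real (A ∩ B) = P.real A * P.real B := by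
  have := indep_iSup_of_disjoint (fun k => (hξ k).comap_le) hind hST
  have h := (Indep_iff _ _ _).1 this A B hA hB
  simp [Measure.real, h, ENNReal.toReal_mul]

/-- Union bound over the time of the large innovation. The event `E k` depends only on the
innovations before time `k`, hence is independent of `ξ k`. -/
theorem measureReal_inter_exceed_le [IsProbabilityMeasure P] (ha₀ : 0 < a)
    (hξ : ∀ n, Measurable (ξ n)) (hind : iIndepFun ξ P) {X : Ω → ℝ}
    (hid : ∀ k t, P.real {ω | t < ξ k ω} = P.real {ω | t < X ω}) {E : ℕ → Set Ω} (hE : Antitone E)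
    (hEm : ∀ j, MeasurableSet[innovationSigma ξ (Set.Iio j)] (E j)) {x y : ℝ} (hy : 0 < y) (n : ℕ) :
    P.real (E n ∩ {ω | a ^ n * x + y < arChain a ξ x n ω}) ≤
      ∑ j ∈ Finset.range n, P.real (E j) * jumpTail P a X y (n - 1 - j) := by
  set t : ℕ → ℝ := fun k =>
    y / (a ^ (n - 1 - k) * (((n - 1 - k : ℕ) + 1) * ((n - 1 - k : ℕ) + 2))) with ht
  calc P.real (E n ∩ {ω | a ^ n * x + y < arChain a ξ x n ω})
      ≤ P.real (⋃ k ∈ Finset.range n, E k ∩ {ω | t k < ξ k ω}) := by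
        refine measureReal_mono ?_ (measure_ne_top _ _)
        rintro ω ⟨h1, h2⟩
        obtain ⟨k, hk, hk2⟩ := exists_large_innovation ha₀ hy h2
        simp only [Set.mem_iUnion]
        exact ⟨k, Finset.mem_range.2 hk, hE hk.le h1, hk2⟩
    _ ≤ ∑ k ∈ Finset.range n, P.real (E k ∩ {ω | t k < ξ k ω}) :=
        measureReal_biUnion_finset_le _ _
    _ = _ := by
        refine Finset.sum_congr rfl fun k _ => ?_
        rw [measureReal_inter_of_disjoint hξ hind (S := Set.Iio k) (T := {k}) (by simp) (hEm k)
          (measurableSet_lt measurable_const (innovation_measurable rfl)), hid]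
        rfl

theorem measureReal_exceed_le [IsProbabilityMeasure P] (ha₀ : 0 < a)
    (hξ : ∀ n, Measurable (ξ n)) (hind : iIndepFun ξ P) {X : Ω → ℝ}
    (hid : ∀ k t, P.real {ω | t < ξ k ω} = P.real {ω | t < X ω}) {y : ℝ} (hy : 0 < y)
    (hs : Summable (jumpTail P a X y)) (s n : ℕ) :
    P.real {ω | y < arChain a (fun k => ξ (s + k)) 0 n ω} ≤ ∑' i, jumpTail P a X y i := by
  have h := measureReal_inter_exceed_le (P := P) (ξ := fun k => ξ (s + k)) ha₀ (fun k => hξ _)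
    (hind.precomp (add_right_injective s)) (fun k => hid _) (E := fun _ => Set.univ)
    antitone_const (fun _ => MeasurableSet.univ) (x := 0) hy n
  simp only [mul_zero, zero_add, Set.univ_inter, probReal_univ, one_mul] at h
  refine h.trans ?_
  rw [Finset.sum_range_reflect]
  exact hs.sum_le_tsum _ fun i _ => jumpTail_nonneg ..

theorem pow_le_measureReal_forall_le [IsProbabilityMeasure P] (hξ : ∀ n, Measurable (ξ n))
    (hind : iIndepFun ξ P) {b κ : ℝ} (hκ0 : 0 ≤ κ) (hκ : ∀ k, κ ≤ P.real {ω | ξ k ω ≤ b}) (s n : ℕ) :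
    κ ^ n ≤ P.real {ω | ∀ k, s ≤ k → k < s + n → ξ k ω ≤ b} := by
  induction n with
  | zero =>
    have : {ω | ∀ k, s ≤ k → k < s + 0 → ξ k ω ≤ b} = Set.univ := by
      ext ω; simp only [Set.mem_univ, iff_true]; intro k h1 h2; omega
    rw [this]; simp
  | succ n ih =>
    have e : {ω | ∀ k, s ≤ k → k < s + (n + 1) → ξ k ω ≤ b} =
        {ω | ∀ k, s ≤ k → k < s + n → ξ k ω ≤ b} ∩ {ω | ξ (s + n) ω ≤ b} := by
      ext ω
      refine ⟨fun h => ⟨fun k h1 h2 => h k h1 (by omega), h _ (by omega) (by omega)⟩,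
        fun h k h1 h2 => ?_⟩
      rcases (show k < s + n ∨ k = s + n by omega) with h3 | rfl
      · exact h.1 k h1 h3
      · exact h.2
    rw [e, measureReal_inter_of_disjoint hξ hind (S := Set.Iio (s + n)) (T := {s + n}) (by simp),
      pow_succ]
    · exact mul_le_mul ih (hκ _) hκ0 measureReal_nonneg
    · have : {ω | ∀ k, s ≤ k → k < s + n → ξ k ω ≤ b} =
          ⋂ k, ⋂ (_ : s ≤ k), ⋂ (_ : k < s + n), {ω | ξ k ω ≤ b} := by ext; simp
      rw [this]
      exact .iInter fun k => .iInter fun _ => .iInter fun hk =>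
        measurableSet_le (innovation_measurable hk) measurable_const
    · exact measurableSet_le (innovation_measurable rfl) measurable_const

/-- The chain started from `0` is below `x₁` at time `B` with probability bounded away from `0`: it
is tight, and from a moderate level a fixed number `L` of consecutive innovations `≤ b` brings it close
to `b / (1 - a) < x₁`. -/
theorem exists_pos_le_measureReal_arChain_le [IsProbabilityMeasure P] (ha₀ : 0 < a) (ha₁ : a < 1)
    (hξ : ∀ n, Measurable (ξ n)) (hind : iIndepFun ξ P) {X : Ω → ℝ}
    (hid : ∀ k t, P.real {ω | t < ξ k ω} = P.real {ω | t < X ω})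
    (hs : ∀ y > 0, Summable (jumpTail P a X y))
    (ht : Tendsto (fun y => ∑' i, jumpTail P a X y i) atTop (𝓝 0))
    {b κ : ℝ} (hb : 0 ≤ b) (hκ0 : 0 < κ) (hκ : ∀ k, κ ≤ P.real {ω | ξ k ω ≤ b})
    {x₁ : ℝ} (hx₁ : b / (1 - a) < x₁) :
    ∃ θ > 0, ∃ B₁, ∀ B ≥ B₁, ∀ s,
      θ ≤ P.real {ω | arChain a (fun k => ξ (s + k)) 0 B ω ≤ x₁} := by
  obtain ⟨Y, hY, hY0⟩ := ((ht.eventually_le_const (show (0 : ℝ) < 1 / 2 by norm_num)).and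
    (eventually_gt_atTop 0)).exists
  have h0 : Tendsto (fun L : ℕ => a ^ L * Y) atTop (𝓝 0) := by
    simpa using (tendsto_pow_atTop_nhds_zero_of_lt_one ha₀.le ha₁).mul_const Y
  obtain ⟨L, hL⟩ := (h0.eventually_le_const (show 0 < x₁ - b / (1 - a) by linarith)).exists
  refine ⟨1 / 2 * κ ^ L, by positivity, L, fun B hB s => ?_⟩
  obtain ⟨m, rfl⟩ := Nat.exists_eq_add_of_le' hB
  have hm : 1 / 2 ≤ P.real {ω | arChain a (fun k => ξ (s + k)) 0 m ω ≤ Y} := by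
    have h1 := measureReal_exceed_le ha₀ hξ hind hid hY0 (hs Y hY0) s m
    have hmeas : Measurable (arChain a (fun k => ξ (s + k)) 0 m) :=
      arChain_measurable a 0 fun k _ => hξ _
    have h2 : P.real {ω | Y < arChain a (fun k => ξ (s + k)) 0 m ω} =
        1 - P.real {ω | arChain a (fun k => ξ (s + k)) 0 m ω ≤ Y} := by
      rw [← probReal_compl_eq_one_sub (measurableSet_le hmeas measurable_const)]
      congr 1; ext ω; simp
    linarith
  calc 1 / 2 * κ ^ L ≤ P.real {ω | arChain a (fun k => ξ (s + k)) 0 m ω ≤ Y} *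
        P.real {ω | ∀ k, s + m ≤ k → k < s + m + L → ξ k ω ≤ b} := by
        gcongr
        exact pow_le_measureReal_forall_le hξ hind hκ0.le hκ (s + m) L
    _ = P.real ({ω | arChain a (fun k => ξ (s + k)) 0 m ω ≤ Y} ∩
        {ω | ∀ k, s + m ≤ k → k < s + m + L → ξ k ω ≤ b}) := by
        refine (measureReal_inter_of_disjoint hξ hind (S := Set.Iio (s + m)) (T := Set.Ici (s + m))
          ?_ ?_ ?_).symm
        · exact Set.Iio_disjoint_Ici le_rfl
        · exact measurableSet_le (shifted_arChain_measurable a fun k _ h => h) measurable_const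
        · have : {ω | ∀ k, s + m ≤ k → k < s + m + L → ξ k ω ≤ b} =
            ⋂ k, ⋂ (_ : s + m ≤ k), ⋂ (_ : k < s + m + L), {ω | ξ k ω ≤ b} := by ext; simp
          rw [this]
          exact .iInter fun k => .iInter fun hk => .iInter fun _ =>
            measurableSet_le (innovation_measurable hk) measurable_const
    _ ≤ _ := by
        refine measureReal_mono ?_
        rintro ω ⟨h1, h2⟩
        have h3 := arChain_le_of_innovation_le ha₀ ha₁ h2 hb
        have h4 := arChain_add a (fun k => ξ (s + k)) 0 m L ω
        simp only [← add_assoc] at h4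
        have h5 : a ^ L * arChain a (fun k => ξ (s + k)) 0 m ω ≤ a ^ L * Y := by
          have := pow_pos ha₀ L
          gcongr; exact h1
        simp only [Set.mem_ofPred_eq]
        rw [h4]
        linarith

/-- The chains restarted from `0` at the beginning of each of the `r` blocks are independent of each
other and of the time before `N`. -/
theorem measureReal_survivalSet_inter_blocks_le [IsProbabilityMeasure P]
    (hξ : ∀ n, Measurable (ξ n)) (hind : iIndepFun ξ P) {θ x₀ x x₁ : ℝ} {B : ℕ} (hθ : θ ≤ 1)
    (hB : ∀ s, θ ≤ P.real {ω | arChain a (fun k => ξ (s + k)) 0 B ω ≤ x₁}) (N r : ℕ) :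
    P.real (survivalSet a ξ x₀ x N ∩
      {ω | ∀ i < r, x₁ < arChain a (fun k => ξ (N + i * B + k)) 0 B ω}) ≤
      (1 - θ) ^ r * P.real (survivalSet a ξ x₀ x N) := by
  induction r with
  | zero => simp
  | succ r ih =>
    set G : ℕ → Set Ω := fun i => {ω | x₁ < arChain a (fun k => ξ (N + i * B + k)) 0 B ω} with hG
    have e : survivalSet a ξ x₀ x N ∩
        {ω | ∀ i < r + 1, x₁ < arChain a (fun k => ξ (N + i * B + k)) 0 B ω} =
        (survivalSet a ξ x₀ x N ∩
          {ω | ∀ i < r, x₁ < arChain a (fun k => ξ (N + i * B + k)) 0 B ω}) ∩ G r := by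
      ext ω
      simp only [Set.mem_inter_iff, Set.mem_ofPred_eq, hG, Nat.lt_succ_iff_lt_or_eq, or_imp,
        forall_and, forall_eq, and_assoc]
    have e2 : {ω | ∀ i < r, x₁ < arChain a (fun k => ξ (N + i * B + k)) 0 B ω} =
        ⋂ i, ⋂ (_ : i < r), G i := by ext; simp [hG]
    rw [e, measureReal_inter_of_disjoint hξ hind (S := Set.Iio (N + r * B))
      (T := Set.Ici (N + r * B))]
    · have h1 : P.real (G r) ≤ 1 - θ := by
        have h2 := hB (N + r * B)
        have hmeas : Measurable (arChain a (fun k => ξ (N + r * B + k)) 0 B) :=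
          arChain_measurable a 0 fun k _ => hξ _
        have h3 : P.real (G r) =
            1 - P.real {ω | arChain a (fun k => ξ (N + r * B + k)) 0 B ω ≤ x₁} := by
          rw [← probReal_compl_eq_one_sub (measurableSet_le hmeas measurable_const)]
          congr 1; ext ω; simp [hG]
        linarith
      rw [pow_succ, mul_right_comm]
      exact mul_le_mul ih h1 measureReal_nonneg
        (mul_nonneg (pow_nonneg (by linarith) _) measureReal_nonneg)
    · exact Set.Iio_disjoint_Ici le_rfl
    · refine MeasurableSet.inter ?_ ?_
      · exact survivalSet_measurableSet (m := innovationSigma ξ _) a x₀ x fun k hk =>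
          innovation_measurable (show k < N + r * B by omega)
      · rw [e2]
        refine .iInter fun i => .iInter fun hi => measurableSet_lt measurable_const
          (shifted_arChain_measurable a fun k _ hk => ?_)
        have : (i + 1) * B ≤ r * B := Nat.mul_le_mul_right _ hi
        simp only [Set.mem_Iio]
        rw [add_mul] at this
        omega
    · exact measurableSet_lt measurable_const (shifted_arChain_measurable a fun k hk _ => hk)

/-- The number `r` of blocks is chosen first, to make `(1 - θ) ^ r` small; then the level `y`, to
make `r * ∑ jumpTail` small; and the block length `B` last, to make `a ^ B * y` small. -/
theorem measureReal_survivalSet_recursion [IsProbabilityMeasure P] (ha₀ : 0 < a) (ha₁ : a < 1)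
    (hξ : ∀ n, Measurable (ξ n)) (hind : iIndepFun ξ P) {X : Ω → ℝ}
    (hid : ∀ k t, P.real {ω | t < ξ k ω} = P.real {ω | t < X ω})
    (hs : ∀ y > 0, Summable (jumpTail P a X y))
    (ht : Tendsto (fun y => ∑' i, jumpTail P a X y i) atTop (𝓝 0))
    {b κ : ℝ} (hb : 0 ≤ b) (hκ0 : 0 < κ) (hκ : ∀ k, κ ≤ P.real {ω | ξ k ω ≤ b})
    {x₀ : ℝ} (hx₀ : b / (1 - a) < x₀) (x : ℝ) {ε : ℝ} (hε : 0 < ε) :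
    ∃ y > 0, ∑' i, jumpTail P a X y i ≤ ε ∧ ∃ W > 0, ∀ᶠ N : ℕ in atTop,
      P.real (survivalSet a ξ x₀ x (N + W)) ≤ ε * P.real (survivalSet a ξ x₀ x N) +
        ∑ j ∈ Finset.range N, P.real (survivalSet a ξ x₀ x j) *
          jumpTail P a X y (N - 1 - j) := by
  obtain ⟨x₁, hx₁, hx₁'⟩ := exists_between hx₀
  obtain ⟨θ, hθ, B₁, hB₁⟩ :=
    exists_pos_le_measureReal_arChain_le ha₀ ha₁ hξ hind hid hs ht hb hκ0 hκ hx₁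
  have hθ1 : θ ≤ 1 := (hB₁ B₁ le_rfl 0).trans measureReal_le_one
  have hpow := tendsto_pow_atTop_nhds_zero_of_lt_one (show 0 ≤ 1 - θ by linarith)
    (show 1 - θ < 1 by linarith)
  obtain ⟨r, hr, hr0⟩ := ((hpow.eventually_le_const (show 0 < ε / 2 by positivity)).and
    (eventually_gt_atTop 0)).exists
  have hr0' : (1 : ℝ) ≤ r := by exact_mod_cast hr0
  obtain ⟨Y₀, hY₀⟩ := eventually_atTop.1
    (ht.eventually_le_const (show 0 < ε / (2 * r) by positivity))
  have hc : 0 < x₀ - x₁ := by linarith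
  have h0 : Tendsto (fun B : ℕ => a ^ B * (4 * max Y₀ 1)) atTop (𝓝 0) := by
    simpa using (tendsto_pow_atTop_nhds_zero_of_lt_one ha₀.le ha₁).mul_const (4 * max Y₀ 1)
  obtain ⟨B, ⟨hBc, hBB⟩, hB0⟩ := ((h0.eventually_le_const hc).and
    (eventually_ge_atTop B₁)).and (eventually_gt_atTop 0) |>.exists
  set y : ℝ := max Y₀ 1 with hydef
  have hy : 0 < y := lt_of_lt_of_le one_pos (le_max_right _ _)
  have hy2 : ∑' i, jumpTail P a X y i ≤ ε / (2 * r) := hY₀ y (le_max_left _ _)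
  refine ⟨y, hy, hy2.trans ?_, r * B, by positivity, ?_⟩
  · exact div_le_self hε.le (by linarith)
  have h1 : Tendsto (fun N : ℕ => a ^ N * x) atTop (𝓝 0) := by
    simpa using (tendsto_pow_atTop_nhds_zero_of_lt_one ha₀.le ha₁).mul_const x
  -- For large `N` the starting point contributes at most `y` to `X_N`.
  filter_upwards [h1.eventually_le_const hy] with N hN
  set D := survivalSet a ξ x₀ x with hD
  have m1 : P.real (⋃ i ∈ Finset.range r, D N ∩
      {ω | y < arChain a (fun k => ξ (N + k)) 0 (i * B) ω}) ≤ ε / 2 * P.real (D N) := by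
    refine (measureReal_biUnion_finset_le _ _).trans ?_
    calc _ ≤ ∑ i ∈ Finset.range r, P.real (D N) * (ε / (2 * r)) := by
          refine Finset.sum_le_sum fun i _ => ?_
          rw [measureReal_inter_of_disjoint hξ hind (S := Set.Iio N) (T := Set.Ici N)]
          · gcongr
            exact (measureReal_exceed_le ha₀ hξ hind hid hy (hs y hy) N (i * B)).trans hy2
          · exact Set.Iio_disjoint_Ici le_rfl
          · exact survivalSet_measurableSet (m := innovationSigma ξ _) a x₀ x fun k hk =>
              innovation_measurable hk
          · exact measurableSet_lt measurable_const
              (shifted_arChain_measurable a fun k hk _ => hk)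
      _ = _ := by
          rw [Finset.sum_const, Finset.card_range, nsmul_eq_mul]
          field_simp
  have m2 : P.real (D N ∩ {ω | 2 * y < arChain a ξ x N ω}) ≤
      ∑ j ∈ Finset.range N, P.real (D j) * jumpTail P a X y (N - 1 - j) := by
    refine le_trans (measureReal_mono ?_) (measureReal_inter_exceed_le ha₀ hξ hind hid
      (survivalSet_anti a ξ x₀ x) (fun j => survivalSet_measurableSet (m := innovationSigma ξ _)
        a x₀ x fun k hk => innovation_measurable hk) (x := x) hy N)
    refine Set.inter_subset_inter_right _ fun ω (hω : 2 * y < _) => ?_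
    simp only [Set.mem_ofPred_eq]
    linarith
  have m3 := measureReal_survivalSet_inter_blocks_le (P := P) (x₀ := x₀) (x := x) hξ hind hθ1
    (fun s => hB₁ B hBB s) N r
  have m4 : (1 - θ) ^ r * P.real (D N) ≤ ε / 2 * P.real (D N) := by gcongr
  have m5 := (measureReal_mono (μ := P)
    (survivalSet_subset_blocks (ξ := ξ) (x := x) ha₀ ha₁ hB0 hy hBc N r)).trans
    ((measureReal_union_le _ _).trans (add_le_add le_rfl (measureReal_union_le _ _)))
  simp only [← hD] at m3 m5
  linarith

end

/-! ### Survival probabilities: the lower bound -/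

section

variable {Ω : Type*} {a : ℝ} {ξ : ℕ → Ω → ℝ}

theorem arChain_nonneg (ha₀ : 0 < a) {x : ℝ} (hx : 0 ≤ x) {ω : Ω} (h : ∀ k, 0 < ξ k ω) (n : ℕ) :
    0 ≤ arChain a ξ x n ω := by
  induction n with
  | zero => exact hx
  | succ n ih =>
    have := h n
    simp only [arChain]
    positivity

/-- A single innovation exceeding `x₀ / a ^ n` keeps the chain above `x₀` until time `n`. -/
theorem mem_survivalSet_of_large_innovation (ha₀ : 0 < a) (ha₁ : a < 1) {x₀ x : ℝ}
    (hx : 0 ≤ x) {ω : Ω} (h : ∀ k, 0 < ξ k ω) {k n : ℕ} (hk : ω ∈ survivalSet a ξ x₀ x k)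
    (hl : x₀ / a ^ n < ξ k ω) : ω ∈ survivalSet a ξ x₀ x n := by
  intro j hj hjn
  rcases le_or_gt j k with hjk | hjk
  · exact hk j hj hjk
  obtain ⟨m, rfl⟩ : ∃ m, j = k + 1 + m := ⟨j - (k + 1), by omega⟩
  rw [arChain_add]
  have h1 := arChain_nonneg (ξ := fun i => ξ (k + 1 + i)) ha₀ le_rfl (fun i => h _) m
  have h2 := arChain_nonneg ha₀ hx h k
  rw [div_lt_iff₀ (pow_pos ha₀ n)] at hl
  have h3 : ξ k ω ≤ arChain a ξ x (k + 1) ω := by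
    simp only [arChain]
    have := mul_nonneg ha₀.le h2
    linarith
  have h4 : a ^ n ≤ a ^ m := pow_le_pow_of_le_one ha₀.le ha₁.le (by omega)
  calc x₀ < ξ k ω * a ^ n := hl
    _ ≤ arChain a ξ x (k + 1) ω * a ^ m :=
        mul_le_mul h3 h4 (pow_pos ha₀ n).le ((h k).le.trans h3)
    _ ≤ _ := by linarith

variable [MeasurableSpace Ω] {P : Measure Ω}

/-- Bonferroni's inequality, where the probability of two exceedances is at most
`P(X > t) ^ 2` by independence. -/
theorem le_measureReal_biUnion_exceed [IsProbabilityMeasure P]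
    (hξ : ∀ n, Measurable (ξ n)) (hind : iIndepFun ξ P) {X : Ω → ℝ}
    (hid : ∀ k t, P.real {ω | t < ξ k ω} = P.real {ω | t < X ω}) {E : ℕ → Set Ω}
    (hEm : ∀ j, MeasurableSet[innovationSigma ξ (Set.Iio j)] (E j)) (t : ℝ) (K : ℕ) :
    P.real {ω | t < X ω} * ∑ k ∈ Finset.range K, P.real (E k) - K ^ 2 * P.real {ω | t < X ω} ^ 2 ≤
      P.real (⋃ k ∈ Finset.range K, E k ∩ {ω | t < ξ k ω}) := by
  set q := P.real {ω | t < X ω} with hq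
  have hq0 : 0 ≤ q := measureReal_nonneg
  have hmV : ∀ k, ∀ S : Set ℕ, k ∈ S → (∀ i < k, i ∈ S) →
      MeasurableSet[innovationSigma ξ S] (E k ∩ {ω | t < ξ k ω}) := by
    intro k S hk hS
    refine MeasurableSet.inter ?_ (measurableSet_lt measurable_const (innovation_measurable hk))
    exact (biSup_mono (f := fun k => MeasurableSpace.comap (ξ k) inferInstance)
      (fun i hi => hS i hi) : innovationSigma ξ (Set.Iio k) ≤ _) _ (hEm k)
  have hV : ∀ k, P.real (E k ∩ {ω | t < ξ k ω}) = P.real (E k) * q := fun k => by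
    rw [measureReal_inter_of_disjoint hξ hind (S := Set.Iio k) (T := {k}) (by simp) (hEm k)
          (measurableSet_lt measurable_const (innovation_measurable rfl)), hid]
  induction K with
  | zero => simp
  | succ K ih =>
    set U := ⋃ k ∈ Finset.range K, E k ∩ {ω | t < ξ k ω} with hU
    have hUm : MeasurableSet[innovationSigma ξ (Set.Iio K)] U :=
      Finset.measurableSet_biUnion _ fun k hk =>
        hmV k _ (Finset.mem_range.1 hk) fun i hi => hi.trans (Finset.mem_range.1 hk)
    have hU1 : P.real U ≤ K * q := by
      refine (measureReal_biUnion_finset_le _ _).trans ?_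
      calc _ ≤ ∑ k ∈ Finset.range K, q := by
            refine Finset.sum_le_sum fun k _ => ?_
            rw [hV]
            exact mul_le_of_le_one_left hq0 measureReal_le_one
        _ = _ := by simp
    have hUV : P.real (U ∩ (E K ∩ {ω | t < ξ K ω})) ≤ K * q * q := by
      calc _ ≤ P.real (U ∩ {ω | t < ξ K ω}) :=
            measureReal_mono (Set.inter_subset_inter_right _ Set.inter_subset_right)
              (measure_ne_top _ _)
        _ = P.real U * q := by
            rw [measureReal_inter_of_disjoint hξ hind (S := Set.Iio K) (T := {K}) (by simp) hUm
              (measurableSet_lt measurable_const (innovation_measurable rfl)), hid]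
        _ ≤ _ := by gcongr
    have e : ⋃ k ∈ Finset.range (K + 1), E k ∩ {ω | t < ξ k ω} =
        U ∪ (E K ∩ {ω | t < ξ K ω}) := by
      rw [Finset.range_add_one, Finset.set_biUnion_insert, Set.union_comm]
    have h1 := measureReal_union_add_inter (μ := P) (s := U) (t := E K ∩ {ω | t < ξ K ω})
      (h₁ := measure_ne_top _ _) (h₂ := measure_ne_top _ _)
      (innovationSigma_le hξ Set.univ _ (hmV K _ trivial fun _ _ => trivial))
    rw [hV] at h1
    rw [e, Finset.sum_range_succ]
    push_cast
    have : 0 ≤ (K : ℝ) * q ^ 2 := by positivity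
    nlinarith [sq_nonneg q]

theorem eventually_le_measureReal_survivalSet [IsProbabilityMeasure P] (ha₀ : 0 < a) (ha₁ : a < 1)
    (hξ : ∀ n, Measurable (ξ n)) (hind : iIndepFun ξ P)
    (hid : ∀ k t, P.real {ω | t < ξ k ω} = P.real {ω | t < ξ 0 ω})
    (hpos : ∀ᵐ ω ∂P, ∀ k, 0 < ξ k ω)
    {η : Ω → ℝ} (hη : ∀ ω, η ω = Real.logb a⁻¹ (ξ 0 ω))
    (hlong : ∀ c : ℝ, ∀ ρ > 1, ∀ᶠ y in atTop, P.real {ω | y < η ω} ≤ ρ * P.real {ω | y + c < η ω})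
    {x₀ x : ℝ} (hx₀ : 0 < x₀) (hx : 0 ≤ x) (K : ℕ) {ε : ℝ} (hε : 0 < ε) :
    ∀ᶠ n : ℕ in atTop,
      (∑ k ∈ Finset.range K, P.real (survivalSet a ξ x₀ x k) - ε) * P.real {ω | (n : ℝ) < η ω} ≤
        P.real (survivalSet a ξ x₀ x n) := by
  set S := ∑ k ∈ Finset.range K, P.real (survivalSet a ξ x₀ x k) with hS
  have hS0 : 0 ≤ S := Finset.sum_nonneg fun _ _ => measureReal_nonneg
  set q : ℕ → ℝ := fun n => P.real {ω | x₀ / a ^ n < ξ 0 ω} with hq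
  have hA := (one_lt_inv₀ ha₀).2 ha₁
  have hqlim : Tendsto (fun n => (K : ℝ) ^ 2 * q n) atTop (𝓝 0) := by
    have h1 : Tendsto (fun n : ℕ => x₀ / a ^ n) atTop atTop := by
      have := (tendsto_pow_atTop_atTop_of_one_lt hA).const_mul_atTop hx₀
      simpa [div_eq_mul_inv] using this
    simpa using ((tendsto_measureReal_lt_atTop P (hξ 0)).comp h1).const_mul ((K : ℝ) ^ 2)
  have hρ : 1 < 1 + ε / (2 * (S + 1)) := by
    have : 0 < ε / (2 * (S + 1)) := by positivity
    linarith
  filter_upwards [hqlim.eventually_le_const (show 0 < ε / 2 by positivity),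
    tendsto_natCast_atTop_atTop.eventually (hlong (Real.logb a⁻¹ x₀) _ hρ)] with n h1 h2
  have hq0 : 0 ≤ q n := measureReal_nonneg
  -- Only almost sure, since `logb` of a negative number is the logarithm of its absolute value.
  have hFq : P.real {ω | (n : ℝ) + Real.logb a⁻¹ x₀ < η ω} ≤ q n := by
    refine ENNReal.toReal_mono (measure_ne_top _ _) (measure_mono_ae ?_)
    filter_upwards [hpos] with ω hω h
    change (n : ℝ) + Real.logb a⁻¹ x₀ < η ω at h
    change x₀ / a ^ n < ξ 0 ω
    rw [hη] at h
    have e : (n : ℝ) + Real.logb a⁻¹ x₀ = Real.logb a⁻¹ (x₀ / a ^ n) := by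
      have h3 : 0 < Real.log a⁻¹ := Real.log_pos hA
      rw [Real.logb, Real.logb, Real.log_div hx₀.ne' (by positivity), Real.log_pow, add_comm,
        sub_div, sub_eq_add_neg, ← neg_div, ← mul_neg, ← Real.log_inv, mul_div_cancel_right₀ _ h3.ne']
    rw [e] at h
    exact (Real.logb_lt_logb_iff hA (by positivity) (hω 0)).1 h
  have hle := le_measureReal_biUnion_exceed (E := survivalSet a ξ x₀ x) hξ hind hid
    (fun j => survivalSet_measurableSet (m := innovationSigma ξ _) a x₀ x fun k hk =>
      innovation_measurable hk) (x₀ / a ^ n) K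
  have hsub : P.real (⋃ k ∈ Finset.range K, survivalSet a ξ x₀ x k ∩ {ω | x₀ / a ^ n < ξ k ω}) ≤
      P.real (survivalSet a ξ x₀ x n) := by
    refine ENNReal.toReal_mono (measure_ne_top _ _) (measure_mono_ae ?_)
    filter_upwards [hpos] with ω hω h
    change ω ∈ ⋃ k ∈ Finset.range K, _ at h
    simp only [Set.mem_iUnion] at h
    obtain ⟨k, -, hk1, hk2⟩ := h
    exact mem_survivalSet_of_large_innovation ha₀ ha₁ hx hω hk1 hk2
  rcases le_or_gt S ε with hSε | hSε
  · exact (mul_nonpos_of_nonpos_of_nonneg (by linarith) measureReal_nonneg).trans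
      measureReal_nonneg
  change q n * S - K ^ 2 * q n ^ 2 ≤ _ at hle
  calc (S - ε) * P.real {ω | (n : ℝ) < η ω}
      ≤ (S - ε) * ((1 + ε / (2 * (S + 1))) * q n) := by
        refine mul_le_mul_of_nonneg_left (h2.trans ?_) (by linarith)
        gcongr
    _ = ((S - ε) + (S - ε) / (S + 1) * (ε / 2)) * q n := by field_simp
    _ ≤ ((S - ε) + 1 * (ε / 2)) * q n := by
        gcongr
        rw [div_le_one (by positivity)]; linarith
    _ ≤ q n * S - K ^ 2 * q n ^ 2 := by nlinarith
    _ ≤ _ := hle.trans hsub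

end

/-! ### The mean recurrence time and the tail asymptotics -/

section

variable {Ω : Type*} {a : ℝ} {ξ : ℕ → Ω → ℝ}

theorem toENNReal_eq_tsum_ite (t : ℕ∞) :
    (t : ℝ≥0∞) = ∑' n : ℕ, if (n : ℕ∞) < t then 1 else 0 := by
  induction t using ENat.recTopCoe with
  | top => simp
  | coe m =>
    rw [tsum_eq_sum (s := Finset.range m) fun n hn => by simpa using hn]
    rw [Finset.sum_congr rfl fun n hn => if_pos (by simpa using hn)]
    simp

theorem lt_recurrenceTime_iff (a : ℝ) (ξ : ℕ → Ω → ℝ) (x₀ x : ℝ) (ω : Ω) (n : ℕ) :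
    (n : ℕ∞) < recurrenceTime a ξ x₀ x ω ↔ ω ∈ survivalSet a ξ x₀ x n := by
  rw [← not_le]
  have := hittingAfter_le_iff (u := arChain a ξ x) (s := Set.Iic x₀) (n := 1) (i := n) (ω := ω)
  refine (not_congr this).trans ?_
  simp [survivalSet]

variable [MeasurableSpace Ω] {P : Measure Ω}

theorem lintegral_recurrenceTime [IsProbabilityMeasure P] (hξ : ∀ n, Measurable (ξ n)) (x₀ x : ℝ) :
    ∫⁻ ω, (recurrenceTime a ξ x₀ x ω : ℝ≥0∞) ∂P = ∑' n, P (survivalSet a ξ x₀ x n) := by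
  have h : ∀ ω, (recurrenceTime a ξ x₀ x ω : ℝ≥0∞) =
      ∑' n, (survivalSet a ξ x₀ x n).indicator 1 ω := by
    intro ω
    classical
    rw [toENNReal_eq_tsum_ite]
    refine tsum_congr fun n => ?_
    simp only [lt_recurrenceTime_iff, Set.indicator_apply, Pi.one_apply]
  have hm : ∀ n, MeasurableSet (survivalSet a ξ x₀ x n) := fun n =>
    survivalSet_measurableSet a x₀ x fun k _ => hξ k
  simp only [h]
  rw [lintegral_tsum fun n => (measurable_one.indicator (hm n)).aemeasurable]
  exact tsum_congr fun n => lintegral_indicator_one (hm n)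

/-- Continuity of the measure gives a level strictly below `c`; it can be taken nonnegative as
`X > 0` almost surely. -/
theorem exists_pos_measureReal_le [IsProbabilityMeasure P] {X : Ω → ℝ} (hX : ∀ᵐ ω ∂P, 0 < X ω)
    {c : ℝ} (h : 0 < P {ω | X ω < c}) : ∃ b, 0 ≤ b ∧ b < c ∧ 0 < P.real {ω | X ω ≤ b} := by
  by_contra! hc
  refine h.ne' ?_
  rcases le_or_gt c 0 with h0 | h0
  · refine measure_mono_null (t := {ω | ¬ 0 < X ω}) (fun ω hω => ?_) (ae_iff.1 hX)
    simp only [Set.mem_ofPred_eq] at hω ⊢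
    linarith
  · have h1 : ∀ k : ℕ, P {ω | X ω ≤ max 0 (c - 1 / ((k : ℝ) + 1))} = 0 := by
      intro k
      have hk : 0 < 1 / ((k : ℝ) + 1) := by positivity
      have := hc _ (le_max_left 0 (c - 1 / ((k : ℝ) + 1))) (max_lt h0 (by linarith))
      exact (measureReal_eq_zero_iff).1 (le_antisymm this measureReal_nonneg)
    refine measure_mono_null (fun ω hω => ?_) (measure_iUnion_null h1)
    simp only [Set.mem_ofPred_eq] at hω
    obtain ⟨k, hk⟩ := exists_nat_one_div_lt (sub_pos.2 hω)
    simp only [Set.mem_iUnion, Set.mem_ofPred_eq]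
    exact ⟨k, le_max_of_le_right (by linarith)⟩

end

theorem theorem5 {Ω : Type*} [MeasurableSpace Ω] (P : Measure Ω) [IsProbabilityMeasure P]
    (a : ℝ) (ha₀ : 0 < a) (ha₁ : a < 1)
    -- positive i.i.d. innovations
    (ξ : ℕ → Ω → ℝ) (hξ_meas : ∀ n, Measurable (ξ n)) (hξ_indep : iIndepFun ξ P)
    (hξ_ident : ∀ n, IdentDistrib (ξ n) (ξ 0) P P) (hξ_pos : ∀ᵐ ω ∂P, 0 < ξ 0 ω)
    -- `η = log_A ξ` with `A = 1 / a`
    (η : Ω → ℝ) (hη : ∀ ω, η ω = Real.logb a⁻¹ (ξ 0 ω))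
    (x₀ : ℝ) (hx₀ : 0 < P {ω | a * x₀ + ξ 0 ω < x₀})
    -- `E η < ∞`, where the value `-∞` is allowed
    (hη_mean : Integrable (fun ω => max (η ω) 0) P)
    (hη_subexp : IsStrongSubexponential (P.map η))
    (hη_log : (fun x : ℝ => P.real {ω | x < η ω}) ~[atTop]
      (fun x : ℝ => P.real {ω | x - Real.log x < η ω}))
    (x : ℝ) (hx : x₀ < x) :
    (∫⁻ ω, (recurrenceTime a ξ x₀ x ω : ℝ≥0∞) ∂P) ≠ ∞ ∧
      (fun n : ℕ => P.real {ω | (n : ℕ∞) < recurrenceTime a ξ x₀ x ω}) ~[atTop]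
        (fun n : ℕ => (∫⁻ ω, (recurrenceTime a ξ x₀ x ω : ℝ≥0∞) ∂P).toReal *
          P.real {ω | (n : ℝ) < η ω}) := by
  have hηm : Measurable η := by
    have : η = fun ω => Real.log (ξ 0 ω) / Real.log a⁻¹ := funext hη
    rw [this]
    exact (Real.measurable_log.comp (hξ_meas 0)).div_const _
  have htail : distTail (P.map η) = fun y => P.real {ω | y < η ω} := by
    funext y
    rw [distTail, map_measureReal_apply hηm measurableSet_Ioi]
    rfl
  obtain ⟨-, hint, hpos, hconv⟩ := hη_subexp
  rw [htail] at hint hpos hconv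
  set F : ℝ → ℝ := fun y => P.real {ω | y < η ω} with hF
  have hanti : Antitone F := fun s t hst =>
    measureReal_mono fun ω (h : t < η ω) => hst.trans_lt h
  have hid : ∀ k t, P.real {ω | t < ξ k ω} = P.real {ω | t < ξ 0 ω} := fun k t => by
    have := (hξ_ident k).measure_mem_eq (measurableSet_Ioi (a := t))
    exact congrArg ENNReal.toReal this
  have hposall : ∀ᵐ ω ∂P, ∀ k, 0 < ξ k ω := ae_all_iff.2 fun k =>
    (hξ_ident k).symm.ae_snd measurableSet_Ioi hξ_pos
  have hx₀' : 0 < P {ω | ξ 0 ω < (1 - a) * x₀} := by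
    convert hx₀ using 4 with ω
    constructor <;> intro h <;> linarith
  obtain ⟨b, hb, hbx, hκ⟩ := exists_pos_measureReal_le hξ_pos hx₀'
  have h1a : 0 < 1 - a := by linarith
  have hbx' : b / (1 - a) < x₀ := by rw [div_lt_iff₀ h1a]; linarith
  have hx₀pos : 0 < x₀ := lt_of_le_of_lt (by positivity) hbx'
  have hκ' : ∀ k, P.real {ω | ξ 0 ω ≤ b} ≤ P.real {ω | ξ k ω ≤ b} := fun k => by
    have := (hξ_ident k).measure_mem_eq (measurableSet_Iic (a := b))
    exact (congrArg ENNReal.toReal this).ge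
  have hFs : Summable fun n : ℕ => F n := summable_tail hpos hanti hint
  have hjs : ∀ y > 0, Summable (jumpTail P a (ξ 0) y) := fun y hy =>
    summable_jumpTail P ha₀ ha₁ hη hpos hη_log hFs hy
  have hjt := tendsto_tsum_jumpTail P ha₀ (hξ_meas 0) hjs
  have hlong := eventually_tail_le_mul_tail_add hpos hanti hη_log
  set p : ℕ → ℝ := fun n => P.real (survivalSet a ξ x₀ x n) with hp
  obtain ⟨hps, hupper⟩ := renewal_inequality (f := fun n : ℕ => F n) (p := p)
    (fun n => hpos n) (fun m n hmn => hanti (Nat.cast_le.2 hmn))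
    (fun k ρ hρ => by
      filter_upwards [tendsto_natCast_atTop_atTop.eventually (hlong k ρ hρ)] with n hn
      push_cast
      exact hn)
    (fun ε hε => eventually_convolution_middle_le hpos hanti hη_log hint hconv hε)
    (fun n => measureReal_nonneg)
    (fun ε hε => by
      obtain ⟨y, hy, hy2, W, hW, hrec⟩ := measureReal_survivalSet_recursion ha₀ ha₁ hξ_meas
        hξ_indep hid hjs hjt hb hκ hκ' hbx' x hε
      exact ⟨jumpTail P a (ξ 0) y, fun i => jumpTail_nonneg .., hjs y hy, hy2,
        eventually_jumpTail_le P ha₀ ha₁ hη hpos hη_log hy, W, hW, hrec⟩)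
  have hET : ∫⁻ ω, (recurrenceTime a ξ x₀ x ω : ℝ≥0∞) ∂P = ENNReal.ofReal (∑' n, p n) := by
    rw [lintegral_recurrenceTime hξ_meas,
      ENNReal.ofReal_tsum_of_nonneg (fun n => measureReal_nonneg) hps]
    exact tsum_congr fun n => (ofReal_measureReal).symm
  have hS0 : 0 ≤ ∑' n, p n := tsum_nonneg fun n => measureReal_nonneg
  rw [hET, ENNReal.toReal_ofReal hS0]
  refine ⟨ENNReal.ofReal_ne_top, ?_⟩
  simp only [lt_recurrenceTime_iff]
  change p ~[atTop] fun n : ℕ => (∑' n, p n) * F n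
  set S := ∑' n, p n with hS
  have hS1 : 0 < S := by
    have h0 : p 0 = 1 := by
      have : survivalSet a ξ x₀ x 0 = Set.univ := by
        ext ω; simp only [Set.mem_univ, iff_true]; intro k h1 h2; omega
      simp [hp, this]
    have := hps.le_tsum 0 fun n _ => measureReal_nonneg
    linarith
  have hlim : Tendsto (fun n : ℕ => p n / F n) atTop (𝓝 S) := by
    refine Metric.tendsto_nhds.2 fun ε hε => ?_
    obtain ⟨K, hK⟩ := (hps.hasSum.tendsto_sum_nat.eventually_const_le
      (show S - ε / 4 < S by linarith)).exists
    filter_upwards [hupper (ε / 2) (by positivity),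
      eventually_le_measureReal_survivalSet ha₀ ha₁ hξ_meas hξ_indep hid hposall hη hlong hx₀pos
        (hx₀pos.le.trans hx.le) K (show 0 < ε / 4 by positivity)] with n h1 h2
    rw [← div_le_iff₀ (hpos n)] at h1
    rw [← le_div_iff₀ (hpos n)] at h2
    change _ ≤ p n / F n at h2
    rw [Real.dist_eq, abs_lt]
    constructor <;> linarith
  rw [isEquivalent_iff_tendsto_one
    (Eventually.of_forall fun n : ℕ => (mul_pos hS1 (hpos n)).ne')]
  have := hlim.div_const S
  rw [div_self hS1.ne'] at this
  refine this.congr fun n => ?_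
  simp only [Pi.div_apply]
  rw [div_div, mul_comm]
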